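/- Let $X_1,\dots,X_n$ be independent Bernoulli random variables with $\mathbb P(X_i=1)=1-\mathbb P(X_i=0)=p_i\in[0,1]$, not all $p_i$ being zero, and let $W=\sum_{i=1}^n X_i$ with law $\mathcal L(W)$. For $r\ge1$ put $\lambda_r=\sum_{i=1}^n p_i^r$, $\lambda=\lambda_1$ and $\theta_r=\lambda_r/\lambda$. Set $$\beta=\frac{\lambda^2}{\lambda_2}-1-2\lambda+\frac{2\lambda_3}{\lambda_2},\qquad \alpha=\beta\lambda+\lambda^2-\lambda_2 .$$ For $a\ge 0$ and $b>0$ let $\mathrm{PBD}(a;0,b,1)$ be the equilibrium distribution of the birth-death process on $\mathbb Z_+=\{0,1,2,\dots\}$ with birth rates $\alpha_i=a$ and death rates $\beta_i=b\,i+i(i-1)$, that is, the distribution with probability function $$\pi_k=\frac{\prod_{i=0}^{k-1}\alpha_i}{\prod_{i=1}^{k}\beta_i}\Bigl(1+\sum_{j=1}^\infty\frac{\prod_{i=0}^{j-1}\alpha_i}{\prod_{i=1}^{j}\beta_i}\Bigr)^{-1},\qquad k\in\mathbb Z_+ .$$ For distributions $\mathcal P,\mathcal Q$ on $\mathbb Z_+$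 with finite mean let $d_W(\mathcal P,\mathcal Q)=\sup_f\bigl|\int f\,d\mathcal P-\int f\,d\mathcal Q\bigr|$ be the Wasserstein distance, the supremum being over all $f:\mathbb Z_+\to\mathbb R$ with $|f(x)-f(y)|\le|x-y|$ for all $x,y\in\mathbb Z_+$. If $\lambda^2/\lambda_2-1-2\lambda\ge0$, then $\alpha>0$ and $\beta>0$, $\mathrm{PBD}(\alpha;0,\beta,1)$ is a well-defined probability distribution with finite mean, $\lambda-\lambda_2-(1+\theta_2)\theta_2>0$, and $$d_W\bigl(\mathcal L(W),\mathrm{PBD}(\alpha;0,\beta,1)\bigr)\le 3\theta_3+\frac{6\,\theta_2\lambda_2}{\lambda-\lambda_2-(1+\theta_2)\theta_2}.$$ -/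

import Mathlib

open MeasureTheory ProbabilityTheory

noncomputable section

/-- The class of test functions on `ℤ₊ = ℕ`: the real functions `f` with
`|f x - f y| ≤ |x - y|` for all `x, y`. -/
def lipschitzTestFunctions : Set (ℕ → ℝ) :=
  {f | ∀ x y : ℕ, |f x - f y| ≤ |(x : ℝ) - (y : ℝ)|}

/-- The Wasserstein distance `sup_f |∫ f dμ - ∫ f dν|` of two distributions on `ℤ₊` (both with
finite mean, so that every test function is integrable), as an extended nonnegative number. -/
def wassersteinDist (μ ν : Measure ℕ) : ENNReal :=
  ⨆ f ∈ lipschitzTestFunctions, ENNReal.ofReal |∫ k, f k ∂μ - ∫ k, f k ∂ν|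

/-- The unnormalised equilibrium weight `∏_{i=0}^{n-1} a i / ∏_{i=1}^n b i` of the birth-death
process on `ℤ₊` with birth rates `a i` and death rates `b i`. -/
def birthDeathWeight (a b : ℕ → ℝ) (n : ℕ) : ℝ :=
  (∏ i ∈ Finset.range n, a i) / ∏ i ∈ Finset.Icc 1 n, b i

/-- The equilibrium probability function
`π_n = weight n * (1 + ∑_{j ≥ 1} weight j)⁻¹` (the series is indexed from `0` here). -/
def birthDeathMass (a b : ℕ → ℝ) (n : ℕ) : ℝ :=
  birthDeathWeight a b n * (1 + ∑' j : ℕ, birthDeathWeight a b (j + 1))⁻¹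

/-- `PBD(α; 0, β, 1)`: the equilibrium distribution on `ℤ₊` with constant birth rate `α` and
death rates `β i + i (i - 1)`, as a measure. -/
def PBD (α β : ℝ) : Measure ℕ :=
  Measure.sum fun n : ℕ =>
    ENNReal.ofReal
      (birthDeathMass (fun _ => α) (fun i => β * (i : ℝ) + (i : ℝ) * ((i : ℝ) - 1)) n) •
        Measure.dirac n

/-- `λ_r = ∑ p_i ^ r`. -/
def powSum {n : ℕ} (p : Fin n → ℝ) (r : ℕ) : ℝ := ∑ i, p i ^ r

/-- `θ_r = λ_r / λ_1`. -/
def thetaRatio {n : ℕ} (p : Fin n → ℝ) (r : ℕ) : ℝ := powSum p r / powSum p 1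

end

/-! This is Stein's method. For a 1-Lipschitz `f`, let `g` solve `α g(k+1) - β_k g(k) = f k - ∑ q
f`, where `q` is the equilibrium mass and `β_k = deathRate β k`. The error for `f` is then the
expectation of the left side at `W`, and two independent estimates bound it.

Matching: size-biasing, applied once to the linear and twice to the quadratic part of the death
rate, followed by reinstating the removed variables, expands this expectation in `E g(W+1)`, `E
Δg(W+1)` and second differences (`bernoulliSumExp_steinOperator`). The values of `α` and `β` are
exactly those that cancel the first two coefficients. The second differences that remain have total
weight at most `2 (λ λ_2 - λ_3) + β λ_3`.

Smoothness: `|Δ²g| ≤ 3/α` away from `0` (`abs_steinSolution_second_difference_le`). Adding the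
identity to `f` makes it monotone with increments at most `2`. For monotone functions, convexity of
two tail ratios bounds `Δ²g` above by an increment over `α`; for the identity, a maximum principle
gives `Δ²g ≥ -1/α`. Subtracting yields `3/α`.

The product of the two bounds is turned into the stated one using `β λ ≤ α` and `λ² D ≤ α λ_2`,
where `D` is the denominator in the statement. -/

/-- The death rate `β k + k (k - 1)` of `PBD(α; 0, β, 1)`. -/
def deathRate (β : ℝ) (k : ℕ) : ℝ := β * (k : ℝ) + (k : ℝ) * ((k : ℝ) - 1)

/-- `q` is a probability function on `ℕ` with finite mean that is in detailed balance with the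
birth rate `α` and the death rates `deathRate β`. -/
structure IsEquilibriumMass (α β : ℝ) (q : ℕ → ℝ) : Prop where
  birth_pos : 0 < α
  death_pos : 0 < β
  pos : ∀ k, 0 < q k
  hasSum_one : HasSum q 1
  summable_mul : Summable fun k : ℕ => q k * (k : ℝ)
  balance : ∀ k, α * q k = deathRate β (k + 1) * q (k + 1)

/-- The solution `g` of the Stein equation `α g(k+1) - β_k g(k) = f k - ∑ q f`, with `g 0 = 0`. -/
noncomputable def steinSolution (α : ℝ) (q f : ℕ → ℝ) : ℕ → ℝ
  | 0 => 0
  | k + 1 => (∑ j ∈ Finset.range (k + 1), q j * (f j - ∑' i, q i * f i)) / (α * q k)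

theorem deathRate_zero (β : ℝ) : deathRate β 0 = 0 := by simp [deathRate]

theorem deathRate_nonneg {β : ℝ} (hβ : 0 < β) (k : ℕ) : 0 ≤ deathRate β k := by
  cases k with
  | zero => simp [deathRate]
  | succ k => simp only [deathRate]; push_cast; ring_nf; positivity

theorem deathRate_succ_pos {β : ℝ} (hβ : 0 < β) (k : ℕ) : 0 < deathRate β (k + 1) := by
  have : deathRate β (k + 1) = ((k : ℝ) + 1) * (β + k) := by
    simp only [deathRate]; push_cast; ring
  rw [this]; positivity

theorem deathRate_succ (β : ℝ) (k : ℕ) : deathRate β (k + 1) = deathRate β k + (β + 2 * k) := by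
  simp only [deathRate]; push_cast; ring

/-- A maximum principle for a killed birth-death generator. -/
theorem nonpos_of_killed_generator_nonneg {a : ℝ} {b c y : ℕ → ℝ} (ha : 0 ≤ a)
    (hb : ∀ k, 0 ≤ b k) (hc : ∀ k, 0 < c k)
    (hy : Filter.Tendsto y Filter.atTop (nhds 0))
    (h : ∀ k, 0 ≤ a * (y (k + 1) - y k) + b k * (y (k - 1) - y k) - c k * y k) (k : ℕ) :
    y k ≤ 0 := by
  by_contra! hk
  obtain ⟨N, hN⟩ := Filter.eventually_atTop.1 (hy.eventually (gt_mem_nhds hk))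
  have hkN : k < N := by
    by_contra! hle
    exact lt_irrefl _ (hN k hle)
  obtain ⟨m, -, hm⟩ := Finset.exists_max_image (Finset.range N) y ⟨k, Finset.mem_range.2 hkN⟩
  have hmk : y k ≤ y m := hm k (Finset.mem_range.2 hkN)
  have hmax : ∀ j, y j ≤ y m := fun j => by
    by_cases hj : j < N
    · exact hm j (Finset.mem_range.2 hj)
    · exact (hN j (not_lt.1 hj)).le.trans hmk
  have h1 := mul_nonneg ha (sub_nonneg.2 (hmax (m + 1)))
  have h2 := mul_nonneg (hb m) (sub_nonneg.2 (hmax (m - 1)))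
  have h3 := mul_pos (hc m) (hk.trans_le hmk)
  have := h m
  linarith

/-! ### Stein solutions of monotone functions: convexity of the tail ratios. -/

namespace IsEquilibriumMass

variable {α β : ℝ} {q : ℕ → ℝ}

theorem summable (h : IsEquilibriumMass α β q) : Summable q := h.hasSum_one.summable

theorem div_succ (h : IsEquilibriumMass α β q) (k : ℕ) :
    q (k + 1) / q k = α / deathRate β (k + 1) := by
  rw [div_eq_div_iff (h.pos k).ne' (deathRate_succ_pos h.death_pos k).ne', h.balance k]
  ring

theorem steinSolution_equation (h : IsEquilibriumMass α β q) (f : ℕ → ℝ) (k : ℕ) :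
    α * steinSolution α q f (k + 1) - deathRate β k * steinSolution α q f k
      = f k - ∑' i, q i * f i := by
  have hα := h.birth_pos.ne'
  cases k with
  | zero =>
    have := (h.pos 0).ne'
    simp [steinSolution, deathRate_zero]
    field_simp
  | succ k =>
    have h1 := (h.pos k).ne'
    have h2 := (h.pos (k + 1)).ne'
    simp only [steinSolution]
    rw [Finset.sum_range_succ, h.balance k]
    have h3 := (deathRate_succ_pos h.death_pos k).ne'
    field_simp
    ring

/-- The convex increasing sequence `∑_{j ≤ k} q j / (α q k)`. -/
noncomputable def lowerRatio (α : ℝ) (q : ℕ → ℝ) (k : ℕ) : ℝ :=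
  (∑ j ∈ Finset.range (k + 1), q j) / (α * q k)

/-- The convex decreasing sequence `∑_{j > k} q j / (α q k)`. -/
noncomputable def upperRatio (α : ℝ) (q : ℕ → ℝ) (k : ℕ) : ℝ :=
  (1 - ∑ j ∈ Finset.range (k + 1), q j) / (α * q k)

theorem lowerRatio_succ (h : IsEquilibriumMass α β q) (k : ℕ) :
    α * lowerRatio α q (k + 1) = 1 + deathRate β (k + 1) * lowerRatio α q k := by
  have hα := h.birth_pos.ne'
  have h1 := (h.pos k).ne'
  have h2 := (h.pos (k + 1)).ne'
  have h3 := (deathRate_succ_pos h.death_pos k).ne'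
  simp only [lowerRatio]
  rw [Finset.sum_range_succ _ (k + 1), h.balance k]
  field_simp
  ring

theorem lowerRatio_nonneg (h : IsEquilibriumMass α β q) (k : ℕ) : 0 ≤ lowerRatio α q k :=
  div_nonneg (Finset.sum_nonneg fun j _ => (h.pos j).le) (mul_pos h.birth_pos (h.pos k)).le

theorem lowerRatio_zero (h : IsEquilibriumMass α β q) : α * lowerRatio α q 0 = 1 := by
  have hα := h.birth_pos.ne'
  have h1 := (h.pos 0).ne'
  simp [lowerRatio]
  field_simp

theorem lowerRatio_mono_succ (h : IsEquilibriumMass α β q) (k : ℕ) :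
    lowerRatio α q k ≤ lowerRatio α q (k + 1) := by
  have hα := h.birth_pos
  refine le_of_mul_le_mul_left ?_ hα
  induction k with
  | zero =>
    rw [h.lowerRatio_succ 0, h.lowerRatio_zero]
    have := mul_nonneg (deathRate_nonneg h.death_pos 1) (h.lowerRatio_nonneg 0)
    simp only [zero_add]
    linarith
  | succ k ih =>
    rw [h.lowerRatio_succ k, h.lowerRatio_succ (k + 1), deathRate_succ β (k + 1)]
    have h1 := le_of_mul_le_mul_left ih hα
    have h2 := mul_le_mul_of_nonneg_left h1 (deathRate_nonneg h.death_pos (k + 1))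
    have h3 : 0 ≤ (β + 2 * ((k + 1 : ℕ) : ℝ)) * lowerRatio α q (k + 1) :=
      mul_nonneg (by have := h.death_pos; positivity) (h.lowerRatio_nonneg _)
    linarith

/-- Take second differences in the recursion `lowerRatio_succ`. Since the death rates are quadratic
with second difference `2`, the discrete Leibniz rule writes the next second difference as a
nonnegative combination of the previous one, the first difference and the value. -/
theorem lowerRatio_convex (h : IsEquilibriumMass α β q) (k : ℕ) :
    0 ≤ lowerRatio α q (k + 2) - 2 * lowerRatio α q (k + 1) + lowerRatio α q k := by
  have hα := h.birth_pos
  have hβ := h.death_pos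
  refine (mul_nonneg_iff_of_pos_left hα).1 ?_
  induction k with
  | zero =>
    have e0 := h.lowerRatio_zero
    have e1 := h.lowerRatio_succ 0
    have e2 := h.lowerRatio_succ 1
    have hA := h.lowerRatio_nonneg 0
    have hm := h.lowerRatio_mono_succ 0
    norm_num [deathRate] at e1 e2 hm ⊢
    nlinarith [mul_nonneg hβ.le (sub_nonneg.2 hm)]
  | succ k ih =>
    have e1 := h.lowerRatio_succ k
    have e2 := h.lowerRatio_succ (k + 1)
    have e3 := h.lowerRatio_succ (k + 2)
    have hA := h.lowerRatio_nonneg k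
    have hm := sub_nonneg.2 (h.lowerRatio_mono_succ k)
    have hv := (mul_nonneg_iff_of_pos_left hα).1 ih
    have t1 := mul_nonneg (deathRate_nonneg hβ (k + 3)) hv
    have t2 : 0 ≤ 2 * (β + 2 * ((k : ℝ) + 2)) * (lowerRatio α q (k + 1) - lowerRatio α q k) := by
      positivity
    have hkey : α * (lowerRatio α q (k + 1 + 2) - 2 * lowerRatio α q (k + 1 + 1)
        + lowerRatio α q (k + 1)) =
      deathRate β (k + 3) * (lowerRatio α q (k + 2) - 2 * lowerRatio α q (k + 1)
        + lowerRatio α q k)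
      + 2 * (β + 2 * ((k : ℝ) + 2)) * (lowerRatio α q (k + 1) - lowerRatio α q k)
      + 2 * lowerRatio α q k := by
      simp only [deathRate] at e1 e2 e3 ⊢
      push_cast at e1 e2 e3 ⊢
      linear_combination e3 - 2 * e2 + e1
    rw [hkey]
    linarith

theorem rate_ratio_convex (h : IsEquilibriumMass α β q) (k : ℕ) :
    0 ≤ α / deathRate β (k + 3) - 2 * (α / deathRate β (k + 2)) + α / deathRate β (k + 1) := by
  have hβ := h.death_pos
  have h1 := deathRate_succ_pos hβ k
  have h2 := deathRate_succ_pos hβ (k + 1)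
  have h3 := deathRate_succ_pos hβ (k + 2)
  have hk : (0 : ℝ) ≤ k := k.cast_nonneg
  have key : 2 * (deathRate β (k + 1) * deathRate β (k + 3))
      ≤ deathRate β (k + 2) * (deathRate β (k + 1) + deathRate β (k + 3)) := by
    simp only [deathRate]
    push_cast
    have e1 : 0 ≤ β * k := by positivity
    have e2 : 0 ≤ β * k ^ 2 := by positivity
    have e3 : 0 ≤ (k : ℝ) ^ 2 := by positivity
    have e4 : 0 ≤ (k : ℝ) ^ 3 := by positivity
    have e5 : 0 ≤ β ^ 2 := by positivity
    nlinarith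
  have : α / deathRate β (k + 3) - 2 * (α / deathRate β (k + 2)) + α / deathRate β (k + 1)
      = α * (deathRate β (k + 2) * (deathRate β (k + 1) + deathRate β (k + 3))
        - 2 * (deathRate β (k + 1) * deathRate β (k + 3)))
        / (deathRate β (k + 1) * deathRate β (k + 2) * deathRate β (k + 3)) := by
    have := h1.ne'
    have := h2.ne'
    have := h3.ne'
    field_simp
    ring
  rw [this]
  exact div_nonneg (mul_nonneg h.birth_pos.le (sub_nonneg.2 key)) (by positivity)

theorem rate_ratio_antitone (h : IsEquilibriumMass α β q) (k : ℕ) :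
    α / deathRate β (k + 2) ≤ α / deathRate β (k + 1) := by
  have hβ := h.death_pos
  refine div_le_div_of_nonneg_left h.birth_pos.le (deathRate_succ_pos hβ k) ?_
  rw [deathRate_succ β (k + 1)]
  have : 0 ≤ β + 2 * ((k + 1 : ℕ) : ℝ) := by positivity
  linarith

theorem shift_ratio_step (h : IsEquilibriumMass α β q) (l k : ℕ) :
    q (k + (l + 1) + 1) / q k = (α / deathRate β (k + 1)) * (q (k + 1 + l + 1) / q (k + 1)) := by
  rw [← h.div_succ k]
  have h1 := (h.pos k).ne'
  have h2 := (h.pos (k + 1)).ne'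
  rw [show k + (l + 1) + 1 = k + 1 + l + 1 by ring]
  field_simp

theorem shift_ratio_antitone (h : IsEquilibriumMass α β q) (l k : ℕ) :
    q (k + 1 + l + 1) / q (k + 1) ≤ q (k + l + 1) / q k := by
  induction l generalizing k with
  | zero => simpa only [add_zero, h.div_succ] using h.rate_ratio_antitone k
  | succ l ih =>
    rw [h.shift_ratio_step l k, h.shift_ratio_step l (k + 1)]
    exact mul_le_mul (h.rate_ratio_antitone k) (ih (k + 1))
      (div_pos (h.pos _) (h.pos _)).le (div_pos h.birth_pos (deathRate_succ_pos h.death_pos k)).le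

/-- The ratio is a product of factors `α / deathRate β j` over `l + 1` consecutive indices, and a
product of nonnegative, decreasing, convex sequences is again of this kind. -/
theorem shift_ratio_convex (h : IsEquilibriumMass α β q) (l k : ℕ) :
    0 ≤ q (k + 2 + l + 1) / q (k + 2) - 2 * (q (k + 1 + l + 1) / q (k + 1))
      + q (k + l + 1) / q k := by
  induction l generalizing k with
  | zero => simpa only [add_zero, h.div_succ] using h.rate_ratio_convex k
  | succ l ih =>
    rw [h.shift_ratio_step l k, h.shift_ratio_step l (k + 1), h.shift_ratio_step l (k + 2)]
    have r1 := (div_pos h.birth_pos (deathRate_succ_pos h.death_pos (k + 1))).le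
    have ra := h.rate_ratio_antitone k
    have rb := h.rate_ratio_antitone (k + 1)
    have rc := h.rate_ratio_convex k
    have t1 := (div_pos (h.pos (k + 2 + l + 1)) (h.pos (k + 2))).le
    have ta := h.shift_ratio_antitone l (k + 1)
    have tb := h.shift_ratio_antitone l (k + 2)
    have tc := ih (k + 1)
    simp only [add_assoc, Nat.reduceAdd] at *
    generalize α / deathRate β (k + 1) = x0 at *
    generalize α / deathRate β (k + 2) = x1 at *
    generalize α / deathRate β (k + 3) = x2 at *
    generalize q (k + (1 + (l + 1))) / q (k + 1) = y0 at *
    generalize q (k + (2 + (l + 1))) / q (k + 2) = y1 at *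
    generalize q (k + (3 + (l + 1))) / q (k + 3) = y2 at *
    -- Leibniz rule centred at the middle index: `Δ²(xy) = x₁ Δ²y + y₁ Δ²x + (x₂ - x₁)(y₂ - y₁) +
    -- (x₀ - x₁)(y₀ - y₁)`.
    nlinarith [mul_nonneg r1 tc, mul_nonneg t1 rc, mul_nonneg (sub_nonneg.2 ra) (sub_nonneg.2 ta),
      mul_nonneg (sub_nonneg.2 rb) (sub_nonneg.2 tb)]

theorem hasSum_upperRatio (h : IsEquilibriumMass α β q) (k : ℕ) :
    HasSum (fun l => q (k + l + 1) / q k) (α * upperRatio α q k) := by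
  have h1 : HasSum (fun l => q (l + (k + 1))) (1 - ∑ j ∈ Finset.range (k + 1), q j) :=
    (hasSum_nat_add_iff' (k + 1)).2 h.hasSum_one
  have h2 := h1.div_const (q k)
  have e : α * upperRatio α q k = (1 - ∑ j ∈ Finset.range (k + 1), q j) / q k := by
    have := h.birth_pos.ne'
    have := (h.pos k).ne'
    simp only [upperRatio]
    field_simp
  rw [e]
  simpa only [add_comm, add_left_comm, add_assoc] using h2

theorem upperRatio_convex (h : IsEquilibriumMass α β q) (k : ℕ) :
    0 ≤ upperRatio α q (k + 2) - 2 * upperRatio α q (k + 1) + upperRatio α q k := by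
  have := ((h.hasSum_upperRatio (k + 2)).sub ((h.hasSum_upperRatio (k + 1)).mul_left 2)).add
    (h.hasSum_upperRatio k)
  have := this.nonneg fun l => h.shift_ratio_convex l k
  refine (mul_nonneg_iff_of_pos_left h.birth_pos).1 ?_
  linarith

theorem summable_of_le (h : IsEquilibriumMass α β q) {f : ℕ → ℝ} {C D : ℝ}
    (hf : ∀ k, |f k| ≤ C + D * k) : Summable fun k => q k * f k := by
  refine Summable.of_norm_bounded ((h.summable.mul_left C).add (h.summable_mul.mul_left D)) ?_
  intro k
  rw [Real.norm_eq_abs, abs_mul, abs_of_pos (h.pos k)]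
  have := mul_le_mul_of_nonneg_left (hf k) (h.pos k).le
  linarith

/-- Up to a convex combination of second differences of `lowerRatio` and `upperRatio`, the second
difference of the Stein solution of a monotone function is governed by a single increment. -/
theorem steinSolution_second_difference_le_of_monotone (h : IsEquilibriumMass α β q)
    {f : ℕ → ℝ} (hf : Monotone f) (hs : Summable fun k => q k * f k) (m : ℕ) :
    steinSolution α q f (m + 3) - 2 * steinSolution α q f (m + 2) + steinSolution α q f (m + 1)
      ≤ (f (m + 2) - f (m + 1)) / α := by
  have hα := h.birth_pos
  set a := f (m + 1) with ha
  -- With `a = f (m + 1)`, monotonicity makes `M` the mean of the negative part of `f - a`, and `E -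
  -- a + M` below the mean of its positive part; hence both are nonnegative.
  set M := ∑ j ∈ Finset.range (m + 1), q j * (a - f j) with hM
  have hM0 : 0 ≤ M := Finset.sum_nonneg fun j hj => mul_nonneg (h.pos j).le
    (sub_nonneg.2 (hf (by have := Finset.mem_range.1 hj; omega)))
  set E := ∑' i, q i * f i with hE
  have hsum : HasSum (fun j => q j * (f j - a)) (E - a) := by
    have := hs.hasSum.sub (h.hasSum_one.mul_right a)
    simp only [one_mul] at this
    simpa only [mul_sub] using this
  have hneg : ∑ j ∈ Finset.range (m + 1), q j * (f j - a) = -M := by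
    rw [hM, ← Finset.sum_neg_distrib]
    exact Finset.sum_congr rfl fun j _ => by ring
  have hM1 : 0 ≤ E - a + M := by
    have h1 := (hasSum_nat_add_iff' (m + 1)).2 hsum
    rw [hneg] at h1
    have := h1.nonneg fun j => mul_nonneg (h.pos _).le (sub_nonneg.2 (hf (by omega)))
    linarith
  have hN : ∀ k, ∑ j ∈ Finset.range (k + 1), q j * (f j - E)
      = ∑ j ∈ Finset.range (k + 1), q j * (f j - a)
        - (E - a) * ∑ j ∈ Finset.range (k + 1), q j := by
    intro k
    rw [Finset.mul_sum, ← Finset.sum_sub_distrib]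
    exact Finset.sum_congr rfl fun j _ => by ring
  -- The shift by `M` makes the first numerator vanish at `k = m` and `k = m + 1`, so it contributes
  -- only at `k = m + 2`; the other two terms are concave in `k`.
  have hg : ∀ k, steinSolution α q f (k + 1)
      = (∑ j ∈ Finset.range (k + 1), q j * (f j - a) + M) / (α * q k)
        - M * upperRatio α q k - (E - a + M) * lowerRatio α q k := by
    intro k
    have := hα.ne'
    have := (h.pos k).ne'
    simp only [steinSolution, upperRatio, lowerRatio]
    rw [← hE, hN k]
    field_simp
    ring
  have e0 : ∑ j ∈ Finset.range (m + 1), q j * (f j - a) + M = 0 := by rw [hneg]; ring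
  have e1 : ∑ j ∈ Finset.range (m + 1 + 1), q j * (f j - a) + M = 0 := by
    rw [Finset.sum_range_succ, hneg]; simp [ha]
  have e2 : ∑ j ∈ Finset.range (m + 2 + 1), q j * (f j - a) + M = q (m + 2) * (f (m + 2) - a) := by
    rw [Finset.sum_range_succ]
    linarith
  rw [hg m, hg (m + 1), hg (m + 2), e0, e1, e2]
  have e3 : q (m + 2) * (f (m + 2) - a) / (α * q (m + 2)) = (f (m + 2) - a) / α := by
    have := (h.pos (m + 2)).ne'
    field_simp
  rw [e3]
  have t1 := mul_nonneg hM0 (h.upperRatio_convex m)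
  have t2 := mul_nonneg hM1 (h.lowerRatio_convex m)
  simp only [zero_div]
  linarith

end IsEquilibriumMass

/-! ### The identity as test function, and the factor `3/α`. -/

namespace IsEquilibriumMass

variable {α β : ℝ} {q : ℕ → ℝ}

theorem steinSolution_add {f g : ℕ → ℝ}
    (hf : Summable fun k => q k * f k) (hg : Summable fun k => q k * g k) (k : ℕ) :
    steinSolution α q (fun j => f j + g j) k = steinSolution α q f k + steinSolution α q g k := by
  cases k with
  | zero => simp [steinSolution]
  | succ k =>
    have e : ∑' i, q i * (f i + g i) = ∑' i, q i * f i + ∑' i, q i * g i := by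
      rw [← hf.tsum_add hg]
      exact tsum_congr fun i => by ring
    simp only [steinSolution]
    rw [e, ← add_div, ← Finset.sum_add_distrib]
    congr 1
    exact Finset.sum_congr rfl fun j _ => by ring

theorem steinSolution_neg (f : ℕ → ℝ) (k : ℕ) :
    steinSolution α q (fun j => -f j) k = -steinSolution α q f k := by
  cases k with
  | zero => simp [steinSolution]
  | succ k =>
    simp only [steinSolution, mul_neg, tsum_neg]
    rw [← neg_div, ← Finset.sum_neg_distrib]
    congr 1
    exact Finset.sum_congr rfl fun j _ => by ring

/-- Only decay at infinity matters here: it supplies the limit required by the maximum principle.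
The numerator is a centred tail, bounded by `T = ∑_{j>k} j q j`; balance and `j k ≤ deathRate β j`
for `j > k` give `(k - α) T ≤ α q k`. -/
theorem abs_steinSolution_id_le (h : IsEquilibriumMass α β q) {k : ℕ} (hk : α < k)
    (hμ : ∑' i, q i * (i : ℝ) ≤ k) :
    |steinSolution α q (fun j => (j : ℝ)) (k + 1)| ≤ 1 / (k - α) := by
  have hα := h.birth_pos
  have hβ := h.death_pos
  have hq := h.pos k
  set μ := ∑' i, q i * (i : ℝ) with hμdef
  have hsum : HasSum (fun j : ℕ => q j * ((j : ℝ) - μ)) 0 := by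
    have := h.summable_mul.hasSum.sub (h.hasSum_one.mul_right μ)
    simpa only [one_mul, ← hμdef, sub_self, mul_sub] using this
  set T := ∑' j : ℕ, q (j + (k + 1)) * ((j + (k + 1) : ℕ) : ℝ) with hT
  have hμ0 : 0 ≤ μ := tsum_nonneg fun i => mul_nonneg (h.pos i).le i.cast_nonneg
  have hk0 : (0 : ℝ) < k := hα.trans hk
  have sT : Summable fun j : ℕ => q (j + (k + 1)) * ((j + (k + 1) : ℕ) : ℝ) :=
    (summable_nat_add_iff (f := fun j : ℕ => q j * (j : ℝ)) (k + 1)).2 h.summable_mul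
  have sR : Summable fun j : ℕ => q (j + (k + 1)) := (summable_nat_add_iff (k + 1)).2 h.summable
  have hR : ∑' j : ℕ, q (j + (k + 1)) ≤ T := by
    refine sR.tsum_le_tsum (fun j => ?_) sT
    have : (1 : ℝ) ≤ ((j + (k + 1) : ℕ) : ℝ) := by exact_mod_cast Nat.le_add_left 1 (j + k)
    exact le_mul_of_one_le_right (h.pos _).le this
  have hkT : k * T ≤ α * (q k + T) := by
    have sQ : Summable fun j : ℕ => α * q (j + k) :=
      ((summable_nat_add_iff k).2 h.summable).mul_left α
    have h1 : k * T ≤ ∑' j : ℕ, α * q (j + k) := by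
      rw [hT, ← tsum_mul_left]
      refine (sT.mul_left _).tsum_le_tsum (fun j => ?_) sQ
      rw [h.balance (j + k), show j + (k + 1) = j + k + 1 by ring]
      have : (k : ℝ) * ((j + k + 1 : ℕ) : ℝ) ≤ deathRate β (j + k + 1) := by
        simp only [deathRate]
        push_cast
        have e1 : (0 : ℝ) ≤ j := j.cast_nonneg
        nlinarith [mul_nonneg hβ.le (show (0 : ℝ) ≤ j + k + 1 by positivity),
          mul_nonneg e1 (show (0 : ℝ) ≤ j + k + 1 by positivity)]
      have := mul_le_mul_of_nonneg_right this (h.pos (j + k + 1)).le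
      linarith
    have h2 : ∑' j : ℕ, α * q (j + k) = α * (q k + ∑' j : ℕ, q (j + (k + 1))) := by
      rw [tsum_mul_left, ((summable_nat_add_iff k).2 h.summable).tsum_eq_zero_add]
      simp only [zero_add, add_assoc, add_comm 1 k]
    have h3 := mul_le_mul_of_nonneg_left hR hα.le
    rw [h2] at h1
    linarith
  have hS : ∑ j ∈ Finset.range (k + 1), q j * ((j : ℝ) - μ)
      = -∑' j : ℕ, q (j + (k + 1)) * (((j + (k + 1) : ℕ) : ℝ) - μ) := by
    have := ((hasSum_nat_add_iff' (k + 1)).2 hsum).tsum_eq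
    rw [this]; ring
  have sS : Summable fun j : ℕ => q (j + (k + 1)) * (((j + (k + 1) : ℕ) : ℝ) - μ) :=
    ((hasSum_nat_add_iff' (k + 1)).2 hsum).summable
  have b0 : 0 ≤ ∑' j : ℕ, q (j + (k + 1)) * (((j + (k + 1) : ℕ) : ℝ) - μ) := by
    refine tsum_nonneg fun j => mul_nonneg (h.pos _).le ?_
    push_cast
    have : (0 : ℝ) ≤ j := j.cast_nonneg
    linarith
  have b1 : ∑' j : ℕ, q (j + (k + 1)) * (((j + (k + 1) : ℕ) : ℝ) - μ) ≤ T :=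
    sS.tsum_le_tsum (fun j => mul_le_mul_of_nonneg_left (by linarith) (h.pos _).le) sT
  simp only [steinSolution]
  rw [← hμdef, hS, abs_div, abs_neg, abs_of_nonneg b0, abs_of_pos (mul_pos hα hq),
    div_le_div_iff₀ (mul_pos hα hq) (sub_pos.2 hk)]
  nlinarith [mul_le_mul_of_nonneg_right b1 (sub_pos.2 hk).le]

theorem tendsto_steinSolution_id (h : IsEquilibriumMass α β q) :
    Filter.Tendsto (fun k => steinSolution α q (fun j => (j : ℝ)) (k + 1))
      Filter.atTop (nhds 0) := by
  have ht : Filter.Tendsto (fun k : ℕ => 1 / ((k : ℝ) - α)) Filter.atTop (nhds 0) := by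
    simp only [one_div]
    exact (Filter.tendsto_atTop_add_const_right _ (-α) tendsto_natCast_atTop_atTop).inv_tendsto_atTop
  refine squeeze_zero_norm' ?_ ht
  filter_upwards [tendsto_natCast_atTop_atTop.eventually (Filter.eventually_gt_atTop α),
    tendsto_natCast_atTop_atTop.eventually
      (Filter.eventually_ge_atTop (∑' i, q i * (i : ℝ)))] with k h1 h2
  exact h.abs_steinSolution_id_le h1 h2

/-- Differencing the Stein equation gives killed birth-death equations for `G k = g (k + 1)` and its
first two differences, each with the previous function as source. The maximum principle gives in
turn `G ≤ 0`, `ΔG ≥ 0`, `Δ²G ≤ 0`. So `ΔG` is nonnegative and decreasing, and `Δ²G ≥ -ΔG ≥ -1/α`. -/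
theorem neg_le_steinSolution_id_second_difference (h : IsEquilibriumMass α β q) (m : ℕ) :
    -(1 / α) ≤ steinSolution α q (fun j => (j : ℝ)) (m + 3)
      - 2 * steinSolution α q (fun j => (j : ℝ)) (m + 2)
      + steinSolution α q (fun j => (j : ℝ)) (m + 1) := by
  have hα := h.birth_pos
  have hβ := h.death_pos
  have hd := deathRate_nonneg hβ
  have hlim := h.tendsto_steinSolution_id
  have hst := h.steinSolution_equation (fun j => (j : ℝ))
  set g := steinSolution α q (fun j => (j : ℝ))
  set μ := ∑' i, q i * (i : ℝ)
  have hlim1 := hlim.comp (Filter.tendsto_add_atTop_nat 1)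
  have hlim2 := hlim.comp (Filter.tendsto_add_atTop_nat 2)
  simp only [Function.comp_def] at hlim1 hlim2
  have hs0 := hst 0
  simp only [deathRate_zero, zero_mul, Nat.cast_zero, zero_add] at hs0
  -- At `k = 0` the truncated `k - 1` is harmless, since the term it occurs in is zero.
  have eqG : ∀ k, α * (g (k + 2) - g (k + 1)) + deathRate β k * (g (k - 1 + 1) - g (k + 1))
      - (β + 2 * k) * g (k + 1) = 1 := by
    intro k
    have h1 := hst (k + 1)
    rw [deathRate_succ] at h1
    push_cast at h1
    cases k with
    | zero =>
      simp only [deathRate_zero, Nat.cast_zero] at h1 ⊢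
      norm_num at h1 ⊢
      linarith
    | succ k =>
      have h0 := hst (k + 1)
      push_cast at h0 h1 ⊢
      linear_combination h1 - h0
  have hG : ∀ k, g (k + 1) ≤ 0 := by
    refine nonpos_of_killed_generator_nonneg (y := fun k => g (k + 1)) (c := fun k => β + 2 * k)
      hα.le hd (fun k => by positivity) hlim fun k => ?_
    have := eqG k
    linarith
  have eqU : ∀ k, α * ((g (k + 3) - g (k + 2)) - (g (k + 2) - g (k + 1)))
      + deathRate β k * ((g (k - 1 + 2) - g (k - 1 + 1)) - (g (k + 2) - g (k + 1)))
      - (2 * β + 4 * k + 2) * (g (k + 2) - g (k + 1)) = 2 * g (k + 1) := by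
    intro k
    have h1 := eqG (k + 1)
    have h0 := eqG k
    rw [deathRate_succ] at h1
    cases k with
    | zero =>
      simp only [deathRate_zero, Nat.cast_zero] at h0 h1 ⊢
      norm_num at h0 h1 ⊢
      linear_combination h1 - h0
    | succ k =>
      simp only [add_tsub_cancel_right] at h0 h1 ⊢
      push_cast at h0 h1 ⊢
      linear_combination h1 - h0
  have hU : ∀ k, -(g (k + 2) - g (k + 1)) ≤ 0 := by
    refine nonpos_of_killed_generator_nonneg (y := fun k => -(g (k + 2) - g (k + 1)))
      (c := fun k => 2 * β + 4 * k + 2)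
      hα.le hd (fun k => by positivity) ?_ fun k => ?_
    · simpa using (hlim1.sub hlim).neg
    · have := eqU k
      have := hG k
      linarith
  have hV : ∀ k, (g (k + 3) - 2 * g (k + 2) + g (k + 1)) ≤ 0 := by
    refine nonpos_of_killed_generator_nonneg (y := fun k => g (k + 3) - 2 * g (k + 2) + g (k + 1))
      (c := fun k => 3 * β + 6 * k + 6)
      hα.le hd (fun k => by positivity) ?_ fun k => ?_
    · simpa using (hlim2.sub (hlim1.const_mul 2)).add hlim
    · have h1 := eqU (k + 1)
      have h0 := eqU k
      have h2 := hU k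
      rw [deathRate_succ] at h1
      cases k with
      | zero =>
        simp only [deathRate_zero, Nat.cast_zero] at h0 h1 h2 ⊢
        norm_num at h0 h1 h2 ⊢
        linarith
      | succ k =>
        simp only [add_tsub_cancel_right] at h0 h1 h2 ⊢
        push_cast at h0 h1 h2 ⊢
        linarith
  -- The equation for `G` at `0` reads `α ΔG 0 = 1 + β G 0`, which is at most `1`; concavity carries
  -- the bound to all `k`.
  have hU0 : ∀ k, α * (g (k + 2) - g (k + 1)) ≤ 1 := by
    intro k
    induction k with
    | zero =>
      have h0 := eqG 0
      have := mul_nonneg hβ.le (neg_nonneg.2 (hG 0))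
      simp only [deathRate_zero, Nat.cast_zero] at h0
      simp only [zero_add] at *
      linarith
    | succ k ih =>
      refine le_trans (mul_le_mul_of_nonneg_left ?_ hα.le) ih
      have := hV k
      linarith
  have h1 := hU0 m
  have h2 := mul_nonneg hα.le (neg_nonneg.2 (hU (m + 1)))
  rw [← neg_div, div_le_iff₀ hα]
  linarith

/-- Write `f = (id + f) - id`: the monotone bound costs `2/α` and the identity `1/α`. The lower
bound is the upper bound for `-f`. -/
theorem abs_steinSolution_second_difference_le (h : IsEquilibriumMass α β q) {f : ℕ → ℝ}
    (hf : f ∈ lipschitzTestFunctions) (m : ℕ) :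
    |steinSolution α q f (m + 3) - 2 * steinSolution α q f (m + 2) + steinSolution α q f (m + 1)|
      ≤ 3 / α := by
  have hα := h.birth_pos
  have hstep : ∀ k, |f (k + 1) - f k| ≤ 1 := fun k => by
    refine (hf (k + 1) k).trans_eq ?_
    push_cast; simp
  have hsf : Summable fun k => q k * f k := by
    refine h.summable_of_le (C := |f 0|) (D := 1) fun k => ?_
    have h1 := hf k 0
    have h2 := abs_add_le (f k - f 0) (f 0)
    simp only [Nat.cast_zero, sub_zero, sub_add_cancel, Nat.abs_cast] at h1 h2
    linarith
  have key : ∀ u : ℕ → ℝ, (∀ k, |u (k + 1) - u k| ≤ 1) → (Summable fun k => q k * u k) →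
      steinSolution α q u (m + 3) - 2 * steinSolution α q u (m + 2) + steinSolution α q u (m + 1)
        ≤ 3 / α := by
    intro u hu hsu
    have hmono : Monotone fun j : ℕ => (j : ℝ) + u j := monotone_nat_of_le_succ fun k => by
      have := (abs_le.1 (hu k)).1
      push_cast
      linarith
    have hs : Summable fun k : ℕ => q k * ((k : ℝ) + u k) := by
      simpa only [mul_add] using h.summable_mul.add hsu
    have h1 := h.steinSolution_second_difference_le_of_monotone hmono hs m
    simp only [steinSolution_add h.summable_mul hsu] at h1
    have h2 := h.neg_le_steinSolution_id_second_difference m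
    have h3 : ((((m + 2 : ℕ) : ℝ) + u (m + 2)) - (((m + 1 : ℕ) : ℝ) + u (m + 1))) / α ≤ 2 / α := by
      refine div_le_div_of_nonneg_right ?_ hα.le
      have := (abs_le.1 (hu (m + 1))).2
      push_cast
      simp only [add_assoc, Nat.reduceAdd] at this
      linarith
    have h4 : 2 / α + 1 / α = 3 / α := by ring
    linarith
  refine abs_le.2 ⟨?_, key f hstep hsf⟩
  have := key (fun j => -f j) (fun k => by rw [← abs_neg, neg_sub_neg, neg_sub]; exact hstep k)
    (by simpa only [mul_neg] using hsf.neg)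
  simp only [steinSolution_neg] at this
  linarith

end IsEquilibriumMass

/-! ### Expectations of functions of Bernoulli sums. -/

section BernoulliSums

variable {ι : Type*} [DecidableEq ι]

/-- The expectation of `φ (∑_{i ∈ s} X i)` for independent Bernoulli variables `X i` with success
probabilities `p i`. -/
noncomputable def bernoulliSumExp (p : ι → ℝ) (s : Finset ι) (φ : ℕ → ℝ) : ℝ :=
  ∑ t ∈ s.powerset, ((∏ i ∈ t, p i) * ∏ i ∈ s \ t, (1 - p i)) * φ t.card

theorem bernoulliSumExp_empty (p : ι → ℝ) (φ : ℕ → ℝ) : bernoulliSumExp p ∅ φ = φ 0 := by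
  simp [bernoulliSumExp]

theorem bernoulliSumExp_insert (p : ι → ℝ) {s : Finset ι} {i : ι} (hi : i ∉ s) (φ : ℕ → ℝ) :
    bernoulliSumExp p (insert i s) φ
      = (1 - p i) * bernoulliSumExp p s φ + p i * bernoulliSumExp p s fun k => φ (k + 1) := by
  simp only [bernoulliSumExp]
  rw [Finset.sum_powerset_insert hi, Finset.mul_sum, Finset.mul_sum]
  congr 1
  · refine Finset.sum_congr rfl fun t ht => ?_
    have hit : i ∉ t := fun h => hi (Finset.mem_powerset.1 ht h)
    rw [Finset.insert_sdiff_of_notMem _ hit, Finset.prod_insert (by simp [hi])]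
    ring
  · refine Finset.sum_congr rfl fun t ht => ?_
    have hit : i ∉ t := fun h => hi (Finset.mem_powerset.1 ht h)
    rw [Finset.insert_sdiff_insert, Finset.sdiff_insert_of_notMem hi, Finset.prod_insert hit,
      Finset.card_insert_of_notMem hit]
    ring

theorem bernoulliSumExp_erase (p : ι → ℝ) {s : Finset ι} {i : ι} (hi : i ∈ s) (φ : ℕ → ℝ) :
    bernoulliSumExp p s φ = (1 - p i) * bernoulliSumExp p (s.erase i) φ
      + p i * bernoulliSumExp p (s.erase i) fun k => φ (k + 1) := by
  rw [← bernoulliSumExp_insert p (Finset.notMem_erase i s), Finset.insert_erase hi]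

theorem bernoulliSumExp_add (p : ι → ℝ) (s : Finset ι) (φ ψ : ℕ → ℝ) :
    bernoulliSumExp p s (fun k => φ k + ψ k)
      = bernoulliSumExp p s φ + bernoulliSumExp p s ψ := by
  simp only [bernoulliSumExp, mul_add, Finset.sum_add_distrib]

theorem bernoulliSumExp_sub (p : ι → ℝ) (s : Finset ι) (φ ψ : ℕ → ℝ) :
    bernoulliSumExp p s (fun k => φ k - ψ k)
      = bernoulliSumExp p s φ - bernoulliSumExp p s ψ := by
  simp only [bernoulliSumExp, mul_sub, Finset.sum_sub_distrib]

theorem bernoulliSumExp_const_mul (p : ι → ℝ) (s : Finset ι) (c : ℝ) (φ : ℕ → ℝ) :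
    bernoulliSumExp p s (fun k => c * φ k) = c * bernoulliSumExp p s φ := by
  simp only [bernoulliSumExp, Finset.mul_sum]
  exact Finset.sum_congr rfl fun t _ => by ring

theorem bernoulliSumExp_const (p : ι → ℝ) (s : Finset ι) (c : ℝ) :
    bernoulliSumExp p s (fun _ => c) = c := by
  induction s using Finset.induction_on with
  | empty => exact bernoulliSumExp_empty p _
  | insert i s hi ih => rw [bernoulliSumExp_insert p hi, ih]; ring

theorem abs_bernoulliSumExp_le {p : ι → ℝ} (hp : ∀ i, p i ∈ Set.Icc (0 : ℝ) 1) (s : Finset ι)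
    {φ : ℕ → ℝ} {C : ℝ} (hφ : ∀ k, |φ k| ≤ C) : |bernoulliSumExp p s φ| ≤ C := by
  induction s using Finset.induction_on generalizing φ with
  | empty => rw [bernoulliSumExp_empty]; exact hφ 0
  | insert i s hi ih =>
    rw [bernoulliSumExp_insert p hi]
    have h0 := (hp i).1
    have h1 := sub_nonneg.2 (hp i).2
    refine (abs_add_le _ _).trans ?_
    rw [abs_mul, abs_mul, abs_of_nonneg h0, abs_of_nonneg h1]
    have e1 := mul_le_mul_of_nonneg_left (ih hφ) h1
    have e2 := mul_le_mul_of_nonneg_left (ih fun k => hφ (k + 1)) h0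
    linarith

/-- The size-bias identity for a sum of independent Bernoulli variables. -/
theorem bernoulliSumExp_cast_mul (p : ι → ℝ) (s : Finset ι) (φ : ℕ → ℝ) :
    bernoulliSumExp p s (fun k => (k : ℝ) * φ k)
      = ∑ i ∈ s, p i * bernoulliSumExp p (s.erase i) fun k => φ (k + 1) := by
  induction s using Finset.induction_on generalizing φ with
  | empty => simp [bernoulliSumExp_empty]
  | insert i s hi ih =>
    have e : (fun k : ℕ => ((k + 1 : ℕ) : ℝ) * φ (k + 1))
        = fun k : ℕ => (k : ℝ) * φ (k + 1) + φ (k + 1) := by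
      funext k; push_cast; ring
    rw [bernoulliSumExp_insert p hi, e, bernoulliSumExp_add, ih, ih fun k => φ (k + 1),
      Finset.sum_insert hi, Finset.erase_insert hi]
    have e2 : ∀ j ∈ s, p j * bernoulliSumExp p ((insert i s).erase j) (fun k => φ (k + 1))
        = (1 - p i) * (p j * bernoulliSumExp p (s.erase j) fun k => φ (k + 1))
          + p i * (p j * bernoulliSumExp p (s.erase j) fun k => φ (k + 1 + 1)) := by
      intro j hj
      have hij : i ≠ j := fun h => hi (h ▸ hj)
      rw [Finset.erase_insert_of_ne hij,
        bernoulliSumExp_insert p (fun h => hi (Finset.mem_of_mem_erase h))]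
      ring
    rw [Finset.sum_congr rfl e2, Finset.sum_add_distrib, ← Finset.mul_sum, ← Finset.mul_sum]
    ring

theorem bernoulliSumExp_second_difference (p : ι → ℝ) (s : Finset ι) (g : ℕ → ℝ) (c : ℕ) :
    bernoulliSumExp p s (fun k => g (k + (c + 2)) - 2 * g (k + (c + 1)) + g (k + c))
      = bernoulliSumExp p s (fun k => g (k + (c + 2)))
        - 2 * bernoulliSumExp p s (fun k => g (k + (c + 1)))
        + bernoulliSumExp p s (fun k => g (k + c)) := by
  rw [bernoulliSumExp_add, bernoulliSumExp_sub, bernoulliSumExp_const_mul]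

/-- Reinstating one Bernoulli variable, up to a second difference. -/
theorem bernoulliSumExp_erase_eq (p : ι → ℝ) {s : Finset ι} {i : ι} (hi : i ∈ s) (g : ℕ → ℝ) :
    bernoulliSumExp p (s.erase i) (fun k => g (k + 1))
      = bernoulliSumExp p s (fun k => g (k + 1))
        - p i * bernoulliSumExp p s (fun k => g (k + 2) - g (k + 1))
        + p i ^ 2 * bernoulliSumExp p (s.erase i)
            (fun k => g (k + 3) - 2 * g (k + 2) + g (k + 1)) := by
  rw [bernoulliSumExp_second_difference p _ g 1, bernoulliSumExp_sub,
    bernoulliSumExp_erase p hi, bernoulliSumExp_erase p hi fun k => g (k + 2)]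
  simp only [add_assoc, Nat.reduceAdd]
  ring

/-- Reinstating two Bernoulli variables, up to second differences. -/
theorem bernoulliSumExp_erase_erase_eq (p : ι → ℝ) {s : Finset ι} {i j : ι} (hi : i ∈ s)
    (hj : j ∈ s.erase i) (g : ℕ → ℝ) :
    bernoulliSumExp p ((s.erase i).erase j) (fun k => g (k + 2))
      = bernoulliSumExp p s (fun k => g (k + 1))
        + (1 - p i - p j) * bernoulliSumExp p s (fun k => g (k + 2) - g (k + 1))
        - ((p i + p j) * (1 - p i) * (1 - p j) * bernoulliSumExp p ((s.erase i).erase j)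
              (fun k => g (k + 3) - 2 * g (k + 2) + g (k + 1))
          + (1 - p i - p j) * (p i * p j) * bernoulliSumExp p ((s.erase i).erase j)
              (fun k => g (k + 4) - 2 * g (k + 3) + g (k + 2))) := by
  rw [bernoulliSumExp_second_difference p _ g 1, bernoulliSumExp_second_difference p _ g 2,
    bernoulliSumExp_sub]
  simp only [bernoulliSumExp_erase p hi]
  simp only [bernoulliSumExp_erase p hj]
  simp only [add_assoc, Nat.reduceAdd]
  ring

end BernoulliSums

/-! ### The Stein operator with matched parameters. -/

theorem sum_sum_erase {n : ℕ} (F : Fin n → Fin n → ℝ) :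
    ∑ i, ∑ j ∈ Finset.univ.erase i, F i j = ∑ i, ∑ j, F i j - ∑ i, F i i := by
  rw [← Finset.sum_sub_distrib]
  exact Finset.sum_congr rfl fun i _ => by rw [Finset.sum_erase_eq_sub (Finset.mem_univ i)]

theorem sum_sum_erase_mul {n : ℕ} (p : Fin n → ℝ) :
    ∑ i, ∑ j ∈ Finset.univ.erase i, p i * p j = powSum p 1 ^ 2 - powSum p 2 := by
  rw [sum_sum_erase]
  simp only [powSum, pow_one, sq, Finset.sum_mul_sum]

theorem sum_sum_erase_mul_add {n : ℕ} (p : Fin n → ℝ) :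
    ∑ i, ∑ j ∈ Finset.univ.erase i, p i * p j * (p i + p j)
      = 2 * (powSum p 1 * powSum p 2 - powSum p 3) := by
  rw [sum_sum_erase]
  have h1 : ∑ i, ∑ j, p i * p j * (p i + p j)
      = (∑ i, p i ^ 2) * (∑ j, p j) + (∑ i, p i) * ∑ j, p j ^ 2 := by
    rw [Finset.sum_mul_sum, Finset.sum_mul_sum, ← Finset.sum_add_distrib]
    refine Finset.sum_congr rfl fun i _ => ?_
    rw [← Finset.sum_add_distrib]
    exact Finset.sum_congr rfl fun j _ => by ring
  have h2 : ∑ i, p i * p i * (p i + p i) = 2 * ∑ i, p i ^ 3 := by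
    rw [Finset.mul_sum]
    exact Finset.sum_congr rfl fun j _ => by ring
  rw [h1, h2]
  simp only [powSum, pow_one]
  ring

/-- The Stein operator of `PBD(α; 0, β, 1)` with matched parameters, applied to a sum of
independent Bernoulli variables, only involves second differences. -/
theorem bernoulliSumExp_steinOperator {n : ℕ} (p : Fin n → ℝ) {α β : ℝ}
    (hβ : β * powSum p 2 = powSum p 1 ^ 2 - powSum p 2
      - 2 * (powSum p 1 * powSum p 2 - powSum p 3))
    (hα : α = β * powSum p 1 + powSum p 1 ^ 2 - powSum p 2) (g : ℕ → ℝ) :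
    bernoulliSumExp p Finset.univ (fun k => α * g (k + 1) - deathRate β k * g k)
      = ∑ i, ∑ j ∈ Finset.univ.erase i, p i * p j *
          ((p i + p j) * (1 - p i) * (1 - p j) *
              bernoulliSumExp p ((Finset.univ.erase i).erase j)
                (fun k => g (k + 3) - 2 * g (k + 2) + g (k + 1))
            + (1 - p i - p j) * (p i * p j) * bernoulliSumExp p ((Finset.univ.erase i).erase j)
                (fun k => g (k + 4) - 2 * g (k + 3) + g (k + 2)))
        - β * ∑ i, p i ^ 3 * bernoulliSumExp p (Finset.univ.erase i)
            (fun k => g (k + 3) - 2 * g (k + 2) + g (k + 1)) := by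
  have e : (fun k : ℕ => α * g (k + 1) - deathRate β k * g k)
      = fun k : ℕ => (α * g (k + 1) - β * ((k : ℝ) * g k))
        - (k : ℝ) * (((k : ℝ) - 1) * g k) := by
    funext k; simp only [deathRate]; ring
  rw [e, bernoulliSumExp_sub, bernoulliSumExp_sub, bernoulliSumExp_const_mul,
    bernoulliSumExp_const_mul, bernoulliSumExp_cast_mul, bernoulliSumExp_cast_mul]
  set EG := bernoulliSumExp p Finset.univ (fun k => g (k + 1)) with hEG
  set d := bernoulliSumExp p Finset.univ (fun k => g (k + 2) - g (k + 1)) with hd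
  have t1 : ∑ i, p i * bernoulliSumExp p (Finset.univ.erase i) (fun k => g (k + 1))
      = powSum p 1 * EG - powSum p 2 * d
        + ∑ i, p i ^ 3 * bernoulliSumExp p (Finset.univ.erase i)
            (fun k => g (k + 3) - 2 * g (k + 2) + g (k + 1)) := by
    simp only [powSum]
    rw [Finset.sum_mul, Finset.sum_mul, ← Finset.sum_sub_distrib, ← Finset.sum_add_distrib]
    refine Finset.sum_congr rfl fun i hi => ?_
    rw [bernoulliSumExp_erase_eq p hi]
    ring
  have t2 : ∑ i, p i * bernoulliSumExp p (Finset.univ.erase i)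
        (fun k => (((k + 1 : ℕ) : ℝ) - 1) * g (k + 1))
      = (∑ i, ∑ j ∈ Finset.univ.erase i, p i * p j) * EG
        + (∑ i, ∑ j ∈ Finset.univ.erase i, p i * p j) * d
        - (∑ i, ∑ j ∈ Finset.univ.erase i, p i * p j * (p i + p j)) * d
        - ∑ i, ∑ j ∈ Finset.univ.erase i, p i * p j *
          ((p i + p j) * (1 - p i) * (1 - p j) *
              bernoulliSumExp p ((Finset.univ.erase i).erase j)
                (fun k => g (k + 3) - 2 * g (k + 2) + g (k + 1))
            + (1 - p i - p j) * (p i * p j) * bernoulliSumExp p ((Finset.univ.erase i).erase j)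
                (fun k => g (k + 4) - 2 * g (k + 3) + g (k + 2))) := by
    simp only [Finset.sum_mul]
    rw [← Finset.sum_add_distrib, ← Finset.sum_sub_distrib, ← Finset.sum_sub_distrib]
    refine Finset.sum_congr rfl fun i hi => ?_
    rw [← Finset.sum_add_distrib, ← Finset.sum_sub_distrib, ← Finset.sum_sub_distrib]
    simp only [Nat.cast_add, Nat.cast_one, add_sub_cancel_right]
    rw [bernoulliSumExp_cast_mul, Finset.mul_sum]
    refine Finset.sum_congr rfl fun j hj => ?_
    simp only [add_assoc, Nat.reduceAdd]
    rw [bernoulliSumExp_erase_erase_eq p hi hj]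
    ring
  rw [t1, t2, sum_sum_erase_mul, sum_sum_erase_mul_add, hα]
  -- `hα` cancels the coefficient of `EG`; `hβ` says that the coefficient of `d` is zero.
  linear_combination d * hβ

/-- This keeps the total weight of the pair terms down to `∑ p_i p_j (p_i + p_j)`. When `a + b ≤ 1`
the cubic terms cancel and the left side is `a + b - (a + b)² + ab`. -/
theorem pair_coefficient_le {a b : ℝ} (ha : a ∈ Set.Icc (0 : ℝ) 1) (hb : b ∈ Set.Icc (0 : ℝ) 1) :
    (a + b) * (1 - a) * (1 - b) + |1 - a - b| * (a * b) ≤ a + b := by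
  obtain ⟨ha0, ha1⟩ := ha
  obtain ⟨hb0, hb1⟩ := hb
  have hab := mul_nonneg ha0 hb0
  rcases abs_cases (1 - a - b) with ⟨h, h'⟩ | ⟨h, h'⟩ <;> rw [h]
  · nlinarith [sq_nonneg (a - b)]
  · nlinarith [sq_nonneg (a - b), mul_nonneg hab (sub_nonneg.2 ha1),
      mul_nonneg hab (sub_nonneg.2 hb1)]

theorem abs_bernoulliSumExp_steinOperator_le {n : ℕ} {p : Fin n → ℝ}
    (hp : ∀ i, p i ∈ Set.Icc (0 : ℝ) 1) {α β : ℝ} (hβ0 : 0 ≤ β)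
    (hβ : β * powSum p 2 = powSum p 1 ^ 2 - powSum p 2
      - 2 * (powSum p 1 * powSum p 2 - powSum p 3))
    (hα : α = β * powSum p 1 + powSum p 1 ^ 2 - powSum p 2) {g : ℕ → ℝ} {C : ℝ}
    (hC : ∀ k, |g (k + 3) - 2 * g (k + 2) + g (k + 1)| ≤ C) :
    |bernoulliSumExp p Finset.univ (fun k => α * g (k + 1) - deathRate β k * g k)|
      ≤ (2 * (powSum p 1 * powSum p 2 - powSum p 3) + β * powSum p 3) * C := by
  rw [bernoulliSumExp_steinOperator p hβ hα g, add_mul]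
  refine (abs_sub _ _).trans (add_le_add ?_ ?_)
  · rw [← sum_sum_erase_mul_add, Finset.sum_mul]
    refine (Finset.abs_sum_le_sum_abs _ _).trans (Finset.sum_le_sum fun i _ => ?_)
    rw [Finset.sum_mul]
    refine (Finset.abs_sum_le_sum_abs _ _).trans (Finset.sum_le_sum fun j _ => ?_)
    have hC0 : 0 ≤ C := (abs_nonneg _).trans (hC 0)
    have hi := hp i
    have hj := hp j
    have hij := mul_nonneg hi.1 hj.1
    have h1 := abs_bernoulliSumExp_le hp ((Finset.univ.erase i).erase j) hC
    have h2 := abs_bernoulliSumExp_le hp ((Finset.univ.erase i).erase j) fun k => hC (k + 1)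
    simp only [add_assoc, Nat.reduceAdd] at h2
    rw [abs_mul, abs_of_nonneg hij, mul_assoc (p i * p j)]
    refine mul_le_mul_of_nonneg_left ?_ hij
    refine (abs_add_le _ _).trans ?_
    have hc : 0 ≤ (p i + p j) * (1 - p i) * (1 - p j) :=
      mul_nonneg (mul_nonneg (add_nonneg hi.1 hj.1) (sub_nonneg.2 hi.2)) (sub_nonneg.2 hj.2)
    rw [abs_mul (_ * _ * _), abs_mul (_ * (p i * p j)), abs_of_nonneg hc,
      abs_mul (1 - p i - p j), abs_of_nonneg hij]
    have e1 := mul_le_mul_of_nonneg_left h1 hc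
    have e2 := mul_le_mul_of_nonneg_left h2 (mul_nonneg (abs_nonneg (1 - p i - p j)) hij)
    have e3 := mul_le_mul_of_nonneg_right (pair_coefficient_le hi hj) hC0
    linarith
  · rw [abs_mul, abs_of_nonneg hβ0, mul_assoc]
    refine mul_le_mul_of_nonneg_left ?_ hβ0
    rw [powSum, Finset.sum_mul]
    refine (Finset.abs_sum_le_sum_abs _ _).trans (Finset.sum_le_sum fun i _ => ?_)
    rw [abs_mul, abs_of_nonneg (pow_nonneg (hp i).1 3)]
    exact mul_le_mul_of_nonneg_left (abs_bernoulliSumExp_le hp _ hC) (pow_nonneg (hp i).1 3)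

/-! ### The equilibrium distribution as a probability measure. -/

/-- The probability function of `PBD(α; 0, β, 1)`. -/
noncomputable def pbdMass (α β : ℝ) : ℕ → ℝ := birthDeathMass (fun _ => α) (deathRate β)

theorem birthDeathWeight_pos {α β : ℝ} (hα : 0 < α) (hβ : 0 < β) (k : ℕ) :
    0 < birthDeathWeight (fun _ => α) (deathRate β) k := by
  refine div_pos (Finset.prod_pos fun _ _ => hα) (Finset.prod_pos fun i hi => ?_)
  obtain ⟨j, rfl⟩ := Nat.exists_eq_add_of_le' (Finset.mem_Icc.1 hi).1
  exact deathRate_succ_pos hβ j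

theorem birthDeathWeight_balance {α β : ℝ} (hβ : 0 < β) (k : ℕ) :
    α * birthDeathWeight (fun _ => α) (deathRate β) k
      = deathRate β (k + 1) * birthDeathWeight (fun _ => α) (deathRate β) (k + 1) := by
  have h1 := (deathRate_succ_pos hβ k).ne'
  simp only [birthDeathWeight]
  rw [Finset.prod_range_succ, Finset.prod_Icc_succ_top (Nat.le_add_left 1 k)]
  rw [mul_comm (∏ i ∈ Finset.Icc 1 k, _), mul_div_assoc', mul_div_assoc',
    mul_div_mul_left _ _ h1, mul_comm]

/-- The factor `k + 1` yields summability of the weights and finiteness of the mean at once. By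
balance, consecutive terms have ratio at most `1/2` once `k ≥ 4 α`. -/
theorem summable_birthDeathWeight_mul {α β : ℝ} (hα : 0 < α) (hβ : 0 < β) :
    Summable fun k : ℕ => birthDeathWeight (fun _ => α) (deathRate β) k * ((k : ℝ) + 1) := by
  refine summable_of_ratio_norm_eventually_le (r := 1 / 2) (by norm_num) ?_
  filter_upwards [tendsto_natCast_atTop_atTop.eventually
    (Filter.eventually_ge_atTop (4 * α))] with k hk
  have hw := birthDeathWeight_pos hα hβ k
  have hw' := birthDeathWeight_pos hα hβ (k + 1)
  have hb := birthDeathWeight_balance (α := α) hβ k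
  rw [Real.norm_of_nonneg (by positivity), Real.norm_of_nonneg (by positivity)]
  have hd := deathRate_succ_pos hβ k
  refine le_of_mul_le_mul_left ?_ hd
  rw [← mul_assoc, ← hb]
  have hk0 : (0 : ℝ) ≤ k := k.cast_nonneg
  have key : α * ((k : ℝ) + 2) * 2 ≤ deathRate β (k + 1) * (k + 1) := by
    simp only [deathRate]
    push_cast
    have e1 : α * ((k : ℝ) + 2) * 2 ≤ 4 * α * (k + 1) := by nlinarith
    have e2 := mul_le_mul_of_nonneg_right hk (show (0 : ℝ) ≤ k + 1 by positivity)
    have e3 : 0 ≤ β * ((k : ℝ) + 1) * (k + 1) := by positivity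
    have e4 : 0 ≤ (k : ℝ) * ((k : ℝ) + 1) * k := by positivity
    nlinarith
  have := mul_le_mul_of_nonneg_right key hw.le
  push_cast
  nlinarith

theorem isEquilibriumMass_pbdMass {α β : ℝ} (hα : 0 < α) (hβ : 0 < β) :
    IsEquilibriumMass α β (pbdMass α β) := by
  set w := birthDeathWeight (fun _ => α) (deathRate β) with hw
  have hwpos : ∀ k, 0 < w k := birthDeathWeight_pos hα hβ
  have hs1 : Summable fun k : ℕ => w k * ((k : ℝ) + 1) := summable_birthDeathWeight_mul hα hβ
  have hs : Summable w := hs1.of_nonneg_of_le (fun k => (hwpos k).le) fun k =>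
    le_mul_of_one_le_right (hwpos k).le (by linarith [k.cast_nonneg (α := ℝ)])
  have hsm : Summable fun k : ℕ => w k * (k : ℝ) := by
    refine (hs1.sub hs).congr fun k => ?_
    ring
  have hZ : 1 + ∑' j : ℕ, w (j + 1) = ∑' j, w j := by
    rw [hs.tsum_eq_zero_add]
    simp [hw, birthDeathWeight]
  have hZpos : 0 < ∑' j, w j := hs.tsum_pos (fun k => (hwpos k).le) 0 (hwpos 0)
  have hq : pbdMass α β = fun k => w k * (∑' j, w j)⁻¹ := by
    funext k
    rw [← hZ]
    rfl
  rw [hq]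
  refine ⟨hα, hβ, fun k => mul_pos (hwpos k) (inv_pos.2 hZpos), ?_, ?_, fun k => ?_⟩
  · have := hs.hasSum.mul_right (∑' j, w j)⁻¹
    rwa [mul_inv_cancel₀ hZpos.ne'] at this
  · refine (hsm.mul_right (∑' j, w j)⁻¹).congr fun k => ?_
    ring
  · have := birthDeathWeight_balance (α := α) hβ k
    rw [← mul_assoc, ← mul_assoc, this]

theorem PBD_eq_sum (α β : ℝ) :
    PBD α β = Measure.sum fun n : ℕ => ENNReal.ofReal (pbdMass α β n) • Measure.dirac n := rfl

theorem isProbabilityMeasure_PBD {α β : ℝ} (hα : 0 < α) (hβ : 0 < β) :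
    IsProbabilityMeasure (PBD α β) := by
  have h := isEquilibriumMass_pbdMass hα hβ
  refine ⟨?_⟩
  rw [PBD_eq_sum, Measure.sum_apply _ MeasurableSet.univ]
  simp only [Measure.smul_apply, measure_univ, smul_eq_mul, mul_one]
  rw [← ENNReal.ofReal_tsum_of_nonneg (fun k => (h.pos k).le) h.summable, h.hasSum_one.tsum_eq,
    ENNReal.ofReal_one]

theorem integrable_PBD {α β : ℝ} (hα : 0 < α) (hβ : 0 < β) :
    Integrable (fun k : ℕ => (k : ℝ)) (PBD α β) := by
  have h := isEquilibriumMass_pbdMass hα hβ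
  rw [PBD_eq_sum]
  refine integrable_sum_dirac (fun _ => ENNReal.ofReal_ne_top) ?_
  simpa [ENNReal.toReal_ofReal (h.pos _).le] using h.summable_mul

theorem integral_PBD {α β : ℝ} (hα : 0 < α) (hβ : 0 < β) (f : ℕ → ℝ) :
    ∫ k, f k ∂PBD α β = ∑' k, pbdMass α β k * f k := by
  have h := isEquilibriumMass_pbdMass hα hβ
  rw [PBD_eq_sum, integral_sum_dirac fun _ => ENNReal.ofReal_ne_top]
  simp [ENNReal.toReal_ofReal (h.pos _).le]

/-! ### The law of `W`. -/

section Law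

variable {Ω ι : Type*} [MeasurableSpace Ω] {P : Measure Ω} [IsProbabilityMeasure P]
  [DecidableEq ι] {p : ι → ℝ} {X : ι → Ω → ℕ}

theorem integral_bernoulliSum (hp : ∀ i, p i ∈ Set.Icc (0 : ℝ) 1) (hXm : ∀ i, Measurable (X i))
    (hXind : iIndepFun X P) (hX1 : ∀ i, P {ω | X i ω = 1} = ENNReal.ofReal (p i))
    (hX0 : ∀ i, P {ω | X i ω = 0} = ENNReal.ofReal (1 - p i)) (s : Finset ι) (φ : ℕ → ℝ) :
    Integrable (fun ω => φ (∑ i ∈ s, X i ω)) P ∧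
      ∫ ω, φ (∑ i ∈ s, X i ω) ∂P = bernoulliSumExp p s φ := by
  induction s using Finset.induction_on generalizing φ with
  | empty => simp [bernoulliSumExp_empty]
  | insert i s hi ih =>
    set S : Ω → ℕ := fun ω => ∑ j ∈ s, X j ω with hS
    have hSm : Measurable S := Finset.measurable_sum s fun j _ => hXm j
    have hind : IndepFun (X i) S P := by
      have := (hXind.indepFun_finsetSum_of_notMem hXm hi).symm
      convert this using 1
      funext ω
      simp [hS]
    -- The masses at `0` and `1` add up to `1`, so all other values are null.
    have hae : ∀ᵐ ω ∂P, X i ω = 0 ∨ X i ω = 1 := by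
      have hm0 : MeasurableSet {ω | X i ω = 0} := hXm i (measurableSet_singleton 0)
      have hm1 : MeasurableSet {ω | X i ω = 1} := hXm i (measurableSet_singleton 1)
      have hdis : Disjoint {ω | X i ω = 0} {ω | X i ω = 1} := by
        rw [Set.disjoint_left]
        intro ω h0 h1
        simp only [Set.mem_ofPred_eq] at h0 h1
        omega
      have hP : P ({ω | X i ω = 0} ∪ {ω | X i ω = 1}) = 1 := by
        rw [measure_union hdis hm1, hX0, hX1, ← ENNReal.ofReal_add (sub_nonneg.2 (hp i).2) (hp i).1]
        simp
      exact (prob_compl_eq_zero_iff (hm0.union hm1)).2 hP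
    have hpart : ∀ (c : ℕ) (r : ℝ), 0 ≤ r → P {ω | X i ω = c} = ENNReal.ofReal r → ∀ ψ : ℕ → ℝ,
        Integrable (fun ω => (if X i ω = c then (1 : ℝ) else 0) * ψ (S ω)) P ∧
        ∫ ω, (if X i ω = c then (1 : ℝ) else 0) * ψ (S ω) ∂P = r * bernoulliSumExp p s ψ := by
      intro c r hr hc ψ
      have hmc : MeasurableSet {ω | X i ω = c} := hXm i (measurableSet_singleton c)
      have hind' : IndepFun (fun ω => if X i ω = c then (1 : ℝ) else 0) (fun ω => ψ (S ω)) P :=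
        hind.comp (φ := fun k => if k = c then (1 : ℝ) else 0) (ψ := ψ)
          (measurable_of_countable _) (measurable_of_countable _)
      have hmeas : Measurable fun ω => if X i ω = c then (1 : ℝ) else 0 :=
        (measurable_of_countable fun k : ℕ => if k = c then (1 : ℝ) else 0).comp (hXm i)
      have hint : Integrable (fun ω => if X i ω = c then (1 : ℝ) else 0) P := by
        refine Integrable.of_bound hmeas.aestronglyMeasurable 1 (Filter.Eventually.of_forall ?_)
        intro ω
        split_ifs <;> simp
      refine ⟨hind'.integrable_mul hint (ih ψ).1, ?_⟩
      rw [hind'.integral_fun_mul_eq_mul_integral hmeas.aestronglyMeasurable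
        (ih ψ).1.aestronglyMeasurable, (ih ψ).2]
      congr 1
      have : (fun ω => if X i ω = c then (1 : ℝ) else 0)
          = Set.indicator {ω | X i ω = c} fun _ => (1 : ℝ) := by
        funext ω
        simp [Set.indicator_apply]
      rw [this, integral_indicator_const _ hmc, measureReal_def, hc, ENNReal.toReal_ofReal hr]
      simp
    obtain ⟨i0, e0⟩ := hpart 0 (1 - p i) (sub_nonneg.2 (hp i).2) (hX0 i) φ
    obtain ⟨i1, e1⟩ := hpart 1 (p i) (hp i).1 (hX1 i) fun k => φ (k + 1)
    have hcongr : (fun ω => (if X i ω = 0 then (1 : ℝ) else 0) * φ (S ω)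
        + (if X i ω = 1 then (1 : ℝ) else 0) * φ (S ω + 1))
        =ᵐ[P] fun ω => φ (∑ j ∈ insert i s, X j ω) := by
      filter_upwards [hae] with ω hω
      rw [Finset.sum_insert hi]
      rcases hω with h | h <;> simp [h, hS, add_comm]
    refine ⟨(i0.add i1).congr hcongr, ?_⟩
    rw [← integral_congr_ae hcongr, integral_add i0 i1, e0, e1, bernoulliSumExp_insert p hi]

end Law

/-! ### Combining the estimates. -/

theorem abs_bernoulliSumExp_sub_le {n : ℕ} {p : Fin n → ℝ} (hp : ∀ i, p i ∈ Set.Icc (0 : ℝ) 1)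
    {α β : ℝ} {q : ℕ → ℝ} (h : IsEquilibriumMass α β q)
    (hβ : β * powSum p 2 = powSum p 1 ^ 2 - powSum p 2
      - 2 * (powSum p 1 * powSum p 2 - powSum p 3))
    (hα : α = β * powSum p 1 + powSum p 1 ^ 2 - powSum p 2) {f : ℕ → ℝ}
    (hf : f ∈ lipschitzTestFunctions) :
    |bernoulliSumExp p Finset.univ f - ∑' k, q k * f k|
      ≤ (2 * (powSum p 1 * powSum p 2 - powSum p 3) + β * powSum p 3) * (3 / α) := by
  have := abs_bernoulliSumExp_steinOperator_le hp h.death_pos.le hβ hα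
    (h.abs_steinSolution_second_difference_le hf)
  simpa only [h.steinSolution_equation f, bernoulliSumExp_sub, bernoulliSumExp_const] using this

theorem theorem2 {Ω : Type*} [MeasurableSpace Ω] (P : Measure Ω) [IsProbabilityMeasure P]
    (n : ℕ) (p : Fin n → ℝ) (hp : ∀ i, p i ∈ Set.Icc (0 : ℝ) 1)
    (X : Fin n → Ω → ℕ) (hXm : ∀ i, Measurable (X i)) (hXind : iIndepFun X P)
    (hX1 : ∀ i, P {ω | X i ω = 1} = ENNReal.ofReal (p i))
    (hX0 : ∀ i, P {ω | X i ω = 0} = ENNReal.ofReal (1 - p i))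
    (hpos : 0 < powSum p 1)
    (α β : ℝ)
    (hβ : β = powSum p 1 ^ 2 / powSum p 2 - 1 - 2 * powSum p 1
      + 2 * powSum p 3 / powSum p 2)
    (hα : α = β * powSum p 1 + powSum p 1 ^ 2 - powSum p 2)
    (hcond : 0 ≤ powSum p 1 ^ 2 / powSum p 2 - 1 - 2 * powSum p 1) :
    0 < α ∧ 0 < β ∧
    IsProbabilityMeasure (PBD α β) ∧
    Integrable (fun k : ℕ => (k : ℝ)) (PBD α β) ∧
    0 < powSum p 1 - powSum p 2 - (1 + thetaRatio p 2) * thetaRatio p 2 ∧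
    wassersteinDist (P.map fun ω => ∑ i, X i ω) (PBD α β) ≤
      ENNReal.ofReal (3 * thetaRatio p 3
        + 6 * thetaRatio p 2 * powSum p 2
          / (powSum p 1 - powSum p 2 - (1 + thetaRatio p 2) * thetaRatio p 2)) := by
  have hpow : ∀ r, 0 < powSum p r := by
    intro r
    obtain ⟨i, hi⟩ : ∃ i, 0 < p i := by
      by_contra! hall
      refine hpos.not_ge (Finset.sum_nonpos fun i _ => ?_)
      rw [pow_one]
      exact hall i
    exact Finset.sum_pos' (fun j _ => pow_nonneg (hp j).1 r) ⟨i, Finset.mem_univ i, pow_pos hi r⟩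
  have h2 := hpow 2
  have h3 := hpow 3
  have hβpos : 0 < β := by
    have : 0 < 2 * powSum p 3 / powSum p 2 := by positivity
    linarith
  have hβ' : β * powSum p 2 = powSum p 1 ^ 2 - powSum p 2
      - 2 * (powSum p 1 * powSum p 2 - powSum p 3) := by
    rw [hβ]
    field_simp
    ring
  have hcond' : powSum p 2 * (1 + 2 * powSum p 1) ≤ powSum p 1 ^ 2 := by
    have : 1 + 2 * powSum p 1 ≤ powSum p 1 ^ 2 / powSum p 2 := by linarith
    rw [le_div_iff₀ h2] at this
    linarith
  have hW : ∀ f : ℕ → ℝ, ∫ k, f k ∂(P.map fun ω => ∑ i, X i ω)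
      = bernoulliSumExp p Finset.univ f := fun f => by
    rw [integral_map (Finset.measurable_sum _ fun i _ => hXm i).aemeasurable
      (measurable_of_countable f).aestronglyMeasurable]
    exact (integral_bernoulliSum hp hXm hXind hX1 hX0 Finset.univ f).2
  have hest := fun (hαpos : 0 < α) (f : ℕ → ℝ) (hf : f ∈ lipschitzTestFunctions) =>
    abs_bernoulliSumExp_sub_le hp (isEquilibriumMass_pbdMass hαpos hβpos) hβ' hα hf
  simp only [thetaRatio]
  generalize powSum p 1 = l at *
  generalize powSum p 2 = l2 at *
  generalize powSum p 3 = l3 at *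
  have hl2 : l2 < l ^ 2 := by nlinarith [mul_pos h2 hpos]
  have hαβ : β * l ≤ α := by linarith
  have hαpos : 0 < α := (mul_pos hβpos hpos).trans_le hαβ
  have hD : 0 < l - l2 - (1 + l2 / l) * (l2 / l) := by
    -- Written so that the first bracket is nonnegative by `hcond'` and the second is positive by
    -- `hl2`.
    have e : l - l2 - (1 + l2 / l) * (l2 / l)
        = (l * (l ^ 2 - l2 * (1 + 2 * l)) + l2 * (l ^ 2 - l2)) / l ^ 2 := by
      field_simp
      ring
    rw [e]
    have := mul_nonneg hpos.le (sub_nonneg.2 hcond')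
    have := mul_pos h2 (sub_pos.2 hl2)
    positivity
  refine ⟨hαpos, hβpos, isProbabilityMeasure_PBD hαpos hβpos, integrable_PBD hαpos hβpos, hD, ?_⟩
  refine iSup₂_le fun f hf => ENNReal.ofReal_le_ofReal ?_
  rw [hW, integral_PBD hαpos hβpos]
  refine (hest hαpos f hf).trans ?_
  set D := l - l2 - (1 + l2 / l) * (l2 / l) with hDdef
  -- In fact `α λ_2 = λ² D + 2 λ λ_3`; the last term is dropped.
  have hαD : l ^ 2 * D ≤ α * l2 := by
    have e : α * l2 = l ^ 2 * D + 2 * l * l3 := by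
      rw [hα, hDdef]
      field_simp
      linear_combination l * hβ'
    have : 0 ≤ 2 * l * l3 := by positivity
    linarith
  have b1 : β * l3 * (3 / α) ≤ 3 * (l3 / l) := by
    rw [mul_div_assoc', mul_div_assoc', div_le_div_iff₀ hαpos hpos]
    nlinarith [mul_le_mul_of_nonneg_left hαβ h3.le]
  -- After discarding `-l3` this is `6 λ λ_2 / α`, bounded using `hαD`.
  have b2 : 2 * (l * l2 - l3) * (3 / α) ≤ 6 * (l2 / l) * l2 / D := by
    have e : 6 * (l2 / l) * l2 / D = 6 * l2 ^ 2 / (l * D) := by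
      field_simp
    rw [e, mul_div_assoc', div_le_div_iff₀ hαpos (by positivity)]
    have t1 := mul_le_mul_of_nonneg_left hαD h2.le
    have t2 : 0 ≤ l3 * (l * D) := by positivity
    nlinarith
  linarith
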